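/- Let $L\ge 0$ be an integer and let $X\sim P_X=\mathcal N(0,\Sigma_X)$ be an $\mathbb R^L$-valued Gaussian source with positive definite covariance matrix $\Sigma_X\succ 0$. A reconstruction $\hat X$ is an $\mathbb R^L$-valued random vector given by a conditional distribution $P_{\hat X|X}$. Let the perception loss be either $\phi(P_X,P_{\hat X})=D(P_{\hat X}\|P_X)$ (Kullback–Leibler divergence) or $\phi(P_X,P_{\hat X})=W_2^2(P_X,P_{\hat X})=\inf\mathbb E\|U-V\|^2$, the infimum being over all couplings $(U,V)$ with $U\sim P_X$ and $V\sim P_{\hat X}$. For $D,P\in[0,\infty]$ let $$R(D,P)=\inf\bigl\{I(X;\hat X)\;:\;P_{\hat X|X}\text{ with }\mathbb E\|X-\hat X\|^2\le D,\ \phi(P_X,P_{\hat X})\le P\bigr\}$$ be the information rate-distortion-perception function. Then: (1) For every reconstruction $\hat X$ with $\mathbb E\|X-\hat X\|^2<\infty$ there is a reconstruction $\hat X_G$, jointly Gaussian with $X$, with $\mathbb E[\hat X_G]=\mathbb E[\hat X]$, $\operatorname{cov}(\hat X_G,\hat X_G)=\operatorname{cov}(\hat X,\hat X)$ and $\operatorname{cov}(X,\hat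 X_G)=\operatorname{cov}(X,\hat X)$, such that $$I(X;\hat X_G)\le I(X;\hat X),\qquad \mathbb E\|X-\hat X_G\|^2\le\mathbb E\|X-\hat X\|^2,\qquad \phi(P_X,P_{\hat X_G})\le\phi(P_X,P_{\hat X}).$$ (2) For every reconstruction $\hat X$ there is a reconstruction $\hat X_G$ that has mean zero and is jointly Gaussian with $X$ and satisfies the same three inequalities. (3) Consequently, without loss of optimality, the reconstruction may be restricted to have mean zero and be jointly Gaussian with $X$: for all $D,P\in[0,\infty]$, the infimum defining $R(D,P)$ is unchanged when it is taken only over those admissible $P_{\hat X|X}$ for which $\hat X$ has mean zero and is jointly Gaussian with $X$. -/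

import Mathlib

open MeasureTheory ProbabilityTheory InformationTheory
open scoped ENNReal

namespace RDP

/-- The space `ℝ^L` with its Euclidean norm. -/
abbrev Vec (L : ℕ) : Type := EuclideanSpace ℝ (Fin L)

variable {L : ℕ}

/-- The joint law of `(X, X̂)`, where `X` has law `μ` and `κ` is the conditional law of `X̂`
given `X`. -/
noncomputable def jointLaw (μ : Measure (Vec L)) (κ : Kernel (Vec L) (Vec L)) :
    Measure (Vec L × Vec L) :=
  μ.compProd κ

/-- The law of the reconstruction `X̂`. -/
noncomputable def reconLaw (μ : Measure (Vec L)) (κ : Kernel (Vec L) (Vec L)) :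
    Measure (Vec L) :=
  (jointLaw μ κ).map Prod.snd

/-- The mutual information `I(X; X̂)` in nats: the Kullback-Leibler divergence of the joint law
from the product of the marginals. -/
noncomputable def mutualInformation (μ : Measure (Vec L)) (κ : Kernel (Vec L) (Vec L)) : ℝ≥0∞ :=
  klDiv (jointLaw μ κ) (μ.prod (reconLaw μ κ))

/-- The expected squared-error distortion `E‖X - X̂‖²`. -/
noncomputable def distortion (μ : Measure (Vec L)) (κ : Kernel (Vec L) (Vec L)) : ℝ≥0∞ :=
  ∫⁻ z, ‖z.1 - z.2‖ₑ ^ 2 ∂(jointLaw μ κ)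

/-- The perception loss `φ(P_X, P_X̂) = D(P_X̂ ‖ P_X)`; note the order of the arguments. -/
noncomputable def klLoss (p q : Measure (Vec L)) : ℝ≥0∞ :=
  klDiv q p

/-- The perception loss `φ(P_X, P_X̂) = W₂²(P_X, P_X̂)`, the infimum of `E‖U - V‖²` over all
couplings of the two laws. -/
noncomputable def wassersteinSqLoss (p q : Measure (Vec L)) : ℝ≥0∞ :=
  ⨅ (π : Measure (Vec L × Vec L)) (_ : π.map Prod.fst = p ∧ π.map Prod.snd = q),
    ∫⁻ z, ‖z.1 - z.2‖ₑ ^ 2 ∂π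

/-- The conditional laws of `X̂` given `X` that meet the distortion constraint `D` and the
perception constraint `P`. -/
def feasible (φ : Measure (Vec L) → Measure (Vec L) → ℝ≥0∞) (μ : Measure (Vec L))
    (D P : ℝ≥0∞) : Set (Kernel (Vec L) (Vec L)) :=
  {κ | IsMarkovKernel κ ∧ distortion μ κ ≤ D ∧ φ μ (reconLaw μ κ) ≤ P}

/-- The information rate-distortion-perception function `R(D, P)`. -/
noncomputable def informationRDP (φ : Measure (Vec L) → Measure (Vec L) → ℝ≥0∞)
    (μ : Measure (Vec L)) (D P : ℝ≥0∞) : ℝ≥0∞ :=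
  ⨅ κ ∈ feasible φ μ D P, mutualInformation μ κ

/-- The mean `E[X̂]` of the reconstruction. -/
noncomputable def reconMean (μ : Measure (Vec L)) (κ : Kernel (Vec L) (Vec L)) : Vec L :=
  ∫ y, y ∂(reconLaw μ κ)

/-- The covariance matrix `cov(X̂, X̂)`. -/
noncomputable def reconCov (μ : Measure (Vec L)) (κ : Kernel (Vec L) (Vec L)) :
    Matrix (Fin L) (Fin L) ℝ :=
  Matrix.of fun i j => covariance (fun y : Vec L => y i) (fun y : Vec L => y j) (reconLaw μ κ)

/-- The cross-covariance matrix `cov(X, X̂)`. -/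
noncomputable def crossCov (μ : Measure (Vec L)) (κ : Kernel (Vec L) (Vec L)) :
    Matrix (Fin L) (Fin L) ℝ :=
  Matrix.of fun i j => covariance (fun z : Vec L × Vec L => z.1 i)
    (fun z : Vec L × Vec L => z.2 j) (jointLaw μ κ)

/-- `X̂` is jointly Gaussian with `X` (possibly with a singular joint covariance). -/
def IsJointlyGaussian (μ : Measure (Vec L)) (κ : Kernel (Vec L) (Vec L)) : Prop :=
  IsGaussian (jointLaw μ κ)

/-- The reconstruction `κ'` is no worse than `κ`: it has no larger mutual information, no larger
distortion and no larger perception loss. -/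
def NoWorse (φ : Measure (Vec L) → Measure (Vec L) → ℝ≥0∞) (μ : Measure (Vec L))
    (κ' κ : Kernel (Vec L) (Vec L)) : Prop :=
  mutualInformation μ κ' ≤ mutualInformation μ κ ∧
    distortion μ κ' ≤ distortion μ κ ∧
    φ μ (reconLaw μ κ') ≤ φ μ (reconLaw μ κ)

end RDP

/-! Let `π` be the law of `(X, X̂)`, `ν` the law of `X̂`, and `πG` a Gaussian law with the
covariance of `π` and first marginal `μ`. Under `πG` the error `W = X - A X̂` of linear least
squares is independent of `X̂`, so the log-density of `πG` relative to the product of its marginals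
is `q (x - A y) - p x`, with `p`, `q` the quadratic log-densities of `X` and `W`. It does not
involve the law of `X̂`: its exponential integrates to one against `μ × ν` for every `ν`, even a
singular one. The Donsker–Varadhan bound then gives `E_π f ≤ I(X; X̂)` for `f` this quadratic,
translated to the mean of `W` under `π`. Since `f` is quadratic, matching covariances give `E_π f =
E_πG f = I(X; X̂_G)`. If `W` is degenerate, `π` lives on a `μ × ν`-null set and `I(X; X̂) = ∞`. This
is `klDiv_prod_gaussian_le`; `klDiv_gaussian_le` is the same argument for the KL perception loss.

Distortion depends only on means and covariances, and centring `X̂` cannot increase it because `X`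
is centred. For `W₂²`, the same Gaussian replacement is applied to each coupling. When the
distortion is infinite, an independent copy of the source serves. -/

namespace RDP

/-! ### Variational bound and exact value for Kullback–Leibler divergence -/

section KL

variable {α : Type*} [MeasurableSpace α]

/-- A form of the Donsker–Varadhan inequality for normalised exponential weights. -/
lemma ofReal_integral_le_klDiv {π ρ : Measure α} [IsProbabilityMeasure π] [IsProbabilityMeasure ρ]
    {f : α → ℝ} (hf : Measurable f) (h1 : ∫⁻ x, ENNReal.ofReal (Real.exp (f x)) ∂ρ = 1)
    (hint : Integrable f π) : ENNReal.ofReal (∫ x, f x ∂π) ≤ klDiv π ρ := by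
  by_cases htop : klDiv π ρ = ∞
  · simp [htop]
  obtain ⟨hac, hllr⟩ := klDiv_ne_top_iff.1 htop
  have hexp : Integrable (fun x ↦ Real.exp (f x)) ρ := by
    refine ⟨(hf.exp).aestronglyMeasurable, ?_⟩
    rw [hasFiniteIntegral_iff_ofReal (ae_of_all _ fun x ↦ (Real.exp_pos _).le), h1]
    exact ENNReal.one_lt_top
  have hexp1 : ∫ x, Real.exp (f x) ∂ρ = 1 := by
    rw [integral_eq_lintegral_of_nonneg_ae (ae_of_all _ fun x ↦ (Real.exp_pos _).le)
      hexp.aestronglyMeasurable, h1, ENNReal.toReal_one]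
  have := isProbabilityMeasure_tilted hexp
  -- The gap in the inequality is the divergence of `π` from the tilted law `exp f • ρ`, nonnegative
  -- by `h3`; the log-normaliser vanishes by `h1`.
  have h2 := integral_llr_tilted_right hac hint hexp hllr
  rw [hexp1, Real.log_one, add_zero] at h2
  have hac' : π ≪ ρ.tilted f := hac.trans (absolutelyContinuous_tilted hexp)
  have hllr' : Integrable (llr π (ρ.tilted f)) π := integrable_llr_tilted_right hac hint hllr hexp
  have h3 := integral_llr_add_sub_measure_univ_nonneg hac' hllr'
  simp only [probReal_univ, add_sub_cancel_right] at h3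
  rw [klDiv_of_ac_of_integrable hac hllr]
  apply ENNReal.ofReal_le_ofReal
  simp only [probReal_univ, add_sub_cancel_right]
  linarith

lemma klDiv_withDensity_exp {ρ : Measure α} [IsProbabilityMeasure ρ] {π : Measure α}
    [IsProbabilityMeasure π] {f : α → ℝ} (hf : Measurable f)
    (h : π = ρ.withDensity fun x ↦ ENNReal.ofReal (Real.exp (f x))) (hint : Integrable f π) :
    klDiv π ρ = ENNReal.ofReal (∫ x, f x ∂π) := by
  have hac : π ≪ ρ := h ▸ withDensity_absolutelyContinuous _ _
  have hd : llr π ρ =ᵐ[π] f := by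
    refine hac.ae_le ?_
    have := Measure.rnDeriv_withDensity ρ (f := fun x ↦ ENNReal.ofReal (Real.exp (f x)))
      (by fun_prop)
    rw [← h] at this
    filter_upwards [this] with x hx
    rw [llr, hx, ENNReal.toReal_ofReal (Real.exp_pos _).le, Real.log_exp]
  rw [klDiv_of_ac_of_integrable hac (hint.congr hd.symm), integral_congr_ae hd]
  simp

end KL

/-! ### Second moments and covariance -/

section Moments

variable {E : Type*} [NormedAddCommGroup E] [NormedSpace ℝ E] [FiniteDimensional ℝ E]
  [MeasurableSpace E] [BorelSpace E] {ι : Type*} [Fintype ι]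

/-- Two measures have the same covariance. -/
def SameCov (π π' : Measure E) : Prop :=
  ∀ ℓ ℓ' : StrongDual ℝ E, cov[ℓ, ℓ'; π] = cov[ℓ, ℓ'; π']

omit [FiniteDimensional ℝ E] [BorelSpace E] in
lemma memLp_clm {p : ℝ≥0∞} {π : Measure E} (hπ : MemLp id p π) {F : Type*} [NormedAddCommGroup F]
    [NormedSpace ℝ F] (T : E →L[ℝ] F) : MemLp (fun z ↦ T z) p π :=
  T.comp_memLp' hπ

omit [FiniteDimensional ℝ E] [BorelSpace E] in
lemma integrable_norm_sq_sub {π : Measure E} [IsProbabilityMeasure π] (hπ : MemLp id 2 π)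
    {F : Type*} [NormedAddCommGroup F] [NormedSpace ℝ F] (T : E →L[ℝ] F) (b : F) :
    Integrable (fun z ↦ ‖T z - b‖ ^ 2) π :=
  ((memLp_clm hπ T).sub (memLp_const b)).integrable_norm_pow (by norm_num)

omit [BorelSpace E] in
lemma integral_norm_sq_sub {π : Measure E} [IsProbabilityMeasure π] (hπ : MemLp id 2 π)
    (T : E →L[ℝ] EuclideanSpace ℝ ι) (b : EuclideanSpace ℝ ι) :
    ∫ z, ‖T z - b‖ ^ 2 ∂π = ∑ i, Var[fun z ↦ T z i; π] + ‖T (∫ z, z ∂π) - b‖ ^ 2 := by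
  have hL (i : ι) : MemLp (fun z ↦ T z i) 2 π :=
    memLp_clm hπ ((EuclideanSpace.proj i : EuclideanSpace ℝ ι →L[ℝ] ℝ).comp T)
  have hm (i : ι) : ∫ z, T z i ∂π = T (∫ z, z ∂π) i :=
    ((EuclideanSpace.proj i : EuclideanSpace ℝ ι →L[ℝ] ℝ).comp T).integral_comp_comm
      (hπ.integrable (by simp))
  simp_rw [EuclideanSpace.real_norm_sq_eq]
  have hi (i : ι) : MemLp (fun z ↦ T z i - b i) 2 π := (hL i).sub (memLp_const _)
  rw [integral_finsetSum]
  · rw [← Finset.sum_add_distrib]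
    refine Finset.sum_congr rfl fun i _ ↦ ?_
    have h1 := variance_eq_sub (hi i)
    have h2 : Var[fun z ↦ T z i - b i; π] = Var[fun z ↦ T z i; π] :=
      variance_sub_const (hL i).1 _
    have h3 : ∫ z, (T z i - b i) ∂π = T (∫ z, z ∂π) i - b i := by
      rw [integral_sub ((hL i).integrable (by simp)) (integrable_const _), hm]
      simp
    rw [h2, h3] at h1
    simp only [Pi.pow_apply, PiLp.sub_apply] at h1 ⊢
    linarith
  · intro i _
    exact (hi i).integrable_sq

/-- The second moment about a point depends only on covariance and on the distance to the mean. -/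
lemma integral_norm_sq_sub_eq_of_sameCov {π π' : Measure E} [IsProbabilityMeasure π]
    [IsProbabilityMeasure π'] (hπ : MemLp id 2 π) (hπ' : MemLp id 2 π') (h : SameCov π π')
    (T : E →L[ℝ] EuclideanSpace ℝ ι) (b b' : EuclideanSpace ℝ ι) :
    ∫ z, ‖T z - b‖ ^ 2 ∂π - ‖T (∫ z, z ∂π) - b‖ ^ 2
      = ∫ z, ‖T z - b'‖ ^ 2 ∂π' - ‖T (∫ z, z ∂π') - b'‖ ^ 2 := by
  rw [integral_norm_sq_sub hπ, integral_norm_sq_sub hπ', add_sub_cancel_right,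
    add_sub_cancel_right]
  refine Finset.sum_congr rfl fun i _ ↦ ?_
  have := h ((EuclideanSpace.proj i : EuclideanSpace ℝ ι →L[ℝ] ℝ).comp T)
    ((EuclideanSpace.proj i : EuclideanSpace ℝ ι →L[ℝ] ℝ).comp T)
  rwa [covariance_self (by fun_prop), covariance_self (by fun_prop)] at this

omit [FiniteDimensional ℝ E] in
lemma covariance_map_clm {F : Type*} [NormedAddCommGroup F] [NormedSpace ℝ F]
    [MeasurableSpace F] [BorelSpace F] (π : Measure E) (T : E →L[ℝ] F) (ℓ ℓ' : StrongDual ℝ F) :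
    cov[ℓ, ℓ'; π.map T] = cov[ℓ.comp T, ℓ'.comp T; π] := by
  rw [covariance_map ℓ.continuous.stronglyMeasurable.aestronglyMeasurable
    ℓ'.continuous.stronglyMeasurable.aestronglyMeasurable (by fun_prop)]
  rfl

omit [FiniteDimensional ℝ E] in
lemma SameCov.map {F : Type*} [NormedAddCommGroup F] [NormedSpace ℝ F]
    [MeasurableSpace F] [BorelSpace F] {π π' : Measure E} (h : SameCov π π') (T : E →L[ℝ] F) :
    SameCov (π.map T) (π'.map T) := fun ℓ ℓ' ↦ by
  rw [covariance_map_clm, covariance_map_clm, h]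

omit [FiniteDimensional ℝ E] in
lemma memLp_id_map {p : ℝ≥0∞} {F : Type*} [NormedAddCommGroup F] [NormedSpace ℝ F]
    [FiniteDimensional ℝ F] [MeasurableSpace F] [BorelSpace F] {π : Measure E}
    (h : MemLp id p π) (T : E →L[ℝ] F) : MemLp id p (π.map T) := by
  have := FiniteDimensional.proper_real F
  exact (memLp_map_measure_iff (by fun_prop) (by fun_prop)).2 (memLp_clm h T)

lemma ext_of_sameCov {π π' : Measure E} [IsGaussian π] [IsGaussian π'] (h : SameCov π π')
    (hm : ∫ z, z ∂π = ∫ z, z ∂π') : π = π' := by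
  refine IsGaussian.ext_covarianceBilinDual hm ?_
  ext ℓ ℓ'
  rw [covarianceBilinDual_eq_covariance IsGaussian.memLp_two_id,
    covarianceBilinDual_eq_covariance IsGaussian.memLp_two_id, h]

end Moments

/-! ### Gaussian laws with prescribed mean and covariance -/

section Existence

lemma dotProduct_covariance_mulVec {Ω ι : Type*} [Fintype ι] [MeasurableSpace Ω] {P : Measure Ω}
    [IsProbabilityMeasure P] {X : ι → Ω → ℝ} (hX : ∀ i, MemLp (X i) 2 P) (x : ι → ℝ) :
    star x ⬝ᵥ (Matrix.of fun i j ↦ cov[X i, X j; P]).mulVec x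
      = Var[fun ω ↦ ∑ i, x i * X i ω; P] := by
  have hm : ∀ i, MemLp (fun ω ↦ x i * X i ω) 2 P := fun i ↦ (hX i).const_mul _
  rw [variance_fun_sum hm]
  simp only [dotProduct, Matrix.mulVec, Matrix.of_apply, Finset.mul_sum, star_trivial]
  refine Finset.sum_congr rfl fun i _ ↦ Finset.sum_congr rfl fun j _ ↦ ?_
  rw [covariance_const_mul_left, covariance_const_mul_right]
  ring

lemma isHermitian_covariance {Ω ι : Type*} [MeasurableSpace Ω] (P : Measure Ω) (X : ι → Ω → ℝ) :
    (Matrix.of fun i j ↦ cov[X i, X j; P]).IsHermitian := by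
  ext i j
  simp [covariance_comm]

lemma posSemidef_covariance {Ω ι : Type*} [Fintype ι] [MeasurableSpace Ω] {P : Measure Ω}
    [IsProbabilityMeasure P] {X : ι → Ω → ℝ} (hX : ∀ i, MemLp (X i) 2 P) :
    (Matrix.of fun i j ↦ cov[X i, X j; P]).PosSemidef :=
  Matrix.PosSemidef.of_dotProduct_mulVec_nonneg (isHermitian_covariance P X) fun x ↦ by
    rw [dotProduct_covariance_mulVec hX]
    exact variance_nonneg _ _

/-- The covariance matrix of a law on a Euclidean space. -/
noncomputable def covMatrix {ι : Type*} [Fintype ι] (π : Measure (EuclideanSpace ℝ ι)) :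
    Matrix ι ι ℝ :=
  Matrix.of fun i j ↦ cov[fun z : EuclideanSpace ℝ ι ↦ z i, fun z ↦ z j; π]

/-- Covariance is bilinear, so it suffices to compare coordinate functionals. The matrix may be
singular. -/
lemma sameCov_multivariateGaussian {ι : Type*} [Fintype ι] [DecidableEq ι]
    {π : Measure (EuclideanSpace ℝ ι)} [IsProbabilityMeasure π] (hπ : MemLp id 2 π)
    (m : EuclideanSpace ℝ ι) : SameCov (multivariateGaussian m (covMatrix π)) π := by
  have hX (i : ι) : MemLp (fun z : EuclideanSpace ℝ ι ↦ z i) 2 π :=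
    memLp_clm hπ (EuclideanSpace.proj i : EuclideanSpace ℝ ι →L[ℝ] ℝ)
  have hS : (covMatrix π).PosSemidef := posSemidef_covariance hX
  intro ℓ ℓ'
  rw [← covarianceBilinDual_eq_covariance IsGaussian.memLp_two_id,
    ← covarianceBilinDual_eq_covariance hπ]
  have key (i j : ι) : covarianceBilinDual (multivariateGaussian m (covMatrix π))
      (EuclideanSpace.proj i) (EuclideanSpace.proj j)
        = covarianceBilinDual π (EuclideanSpace.proj i) (EuclideanSpace.proj j) := by
    rw [covarianceBilinDual_eq_covariance IsGaussian.memLp_two_id,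
      covarianceBilinDual_eq_covariance hπ]
    exact covariance_eval_multivariateGaussian hS i j
  have hℓ (ℓ : StrongDual ℝ (EuclideanSpace ℝ ι)) :
      ℓ = ∑ i, ℓ (EuclideanSpace.single i 1) •
        (EuclideanSpace.proj i : StrongDual ℝ (EuclideanSpace ℝ ι)) := by
    ext z
    conv_lhs => rw [← (EuclideanSpace.basisFun ι ℝ).sum_repr z]
    simp [mul_comm]
  rw [hℓ ℓ, hℓ ℓ']
  simp only [map_sum, map_smul, sum_apply, smul_apply, key]

/-- Transport through linear coordinates; this generality is needed for `𝔼 × 𝔼`, which does not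
carry the Euclidean norm. The free mean `m` later allows centring. -/
lemma exists_gaussian_sameCov {E : Type*} [NormedAddCommGroup E] [NormedSpace ℝ E]
    [FiniteDimensional ℝ E] [MeasurableSpace E] [BorelSpace E] {π : Measure E}
    [IsProbabilityMeasure π] (hπ : MemLp id 2 π) (m : E) :
    ∃ G : Measure E, IsGaussian G ∧ ∫ z, z ∂G = m ∧ SameCov G π := by
  let e : E ≃L[ℝ] EuclideanSpace ℝ (Fin (Module.finrank ℝ E)) := toEuclidean
  let f : E →L[ℝ] EuclideanSpace ℝ (Fin (Module.finrank ℝ E)) := e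
  let g : EuclideanSpace ℝ (Fin (Module.finrank ℝ E)) →L[ℝ] E := e.symm
  have : IsProbabilityMeasure (π.map f) := Measure.isProbabilityMeasure_map (by fun_prop)
  have hc := (sameCov_multivariateGaussian (memLp_id_map hπ f) (e m)).map g
  refine ⟨(multivariateGaussian (e m) (covMatrix (π.map f))).map g, inferInstance, ?_, ?_⟩
  · rw [ContinuousLinearMap.integral_id_map IsGaussian.integrable_id,
      integral_id_multivariateGaussian]
    exact e.symm_apply_apply m
  · rw [Measure.map_map (by fun_prop) (by fun_prop)] at hc
    have h2 : g ∘ f = id := funext e.symm_apply_apply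
    rwa [h2, Measure.map_id] at hc

end Existence

/-! ### Densities of nondegenerate Gaussian laws -/

section Density

variable {ι : Type*} [Fintype ι]

lemma pi_withDensity_ofReal {f : ι → ℝ → ℝ} (hf : ∀ i, Integrable (f i)) (h0 : ∀ i x, 0 ≤ f i x)
    (h : ∀ i, SigmaFinite ((volume : Measure ℝ).withDensity fun x ↦ ENNReal.ofReal (f i x))) :
    Measure.pi (fun i ↦ (volume : Measure ℝ).withDensity fun x ↦ ENNReal.ofReal (f i x))
      = (volume : Measure (ι → ℝ)).withDensity fun x ↦ ENNReal.ofReal (∏ i, f i (x i)) := by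
  refine Measure.pi_eq fun s hs ↦ ?_
  rw [withDensity_apply _ (MeasurableSet.univ_pi hs), volume_pi, Measure.restrict_pi_pi,
    ← ofReal_integral_eq_lintegral_ofReal
      (Integrable.fintype_prod fun i ↦ (hf i).integrableOn)
      (ae_of_all _ fun x ↦ Finset.prod_nonneg fun i _ ↦ h0 i (x i)),
    integral_fintype_prod_eq_prod, ENNReal.ofReal_prod_of_nonneg
      fun i _ ↦ integral_nonneg (h0 i)]
  refine Finset.prod_congr rfl fun i _ ↦ ?_
  rw [withDensity_apply _ (hs i), ofReal_integral_eq_lintegral_ofReal (hf i).integrableOn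
    (ae_of_all _ (h0 i))]

lemma map_withDensity_of_equiv {α β : Type*} [MeasurableSpace α] [MeasurableSpace β]
    (e : α ≃ᵐ β) (μ : Measure α) (f : α → ℝ≥0∞) :
    (μ.withDensity f).map e = (μ.map e).withDensity (f ∘ e.symm) := by
  ext s hs
  rw [Measure.map_apply e.measurable hs, withDensity_apply _ (e.measurable hs),
    withDensity_apply _ hs, e.restrict_map, lintegral_map_equiv]
  simp

lemma stdGaussian_eq_withDensity :
    ∃ c : ℝ, stdGaussian (EuclideanSpace ℝ ι)
      = volume.withDensity fun x ↦ ENNReal.ofReal (Real.exp (c - 2⁻¹ * ‖x‖ ^ 2)) := by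
  classical
  have h1 : gaussianReal 0 1
      = volume.withDensity fun x ↦ ENNReal.ofReal (gaussianPDFReal 0 1 x) :=
    gaussianReal_of_var_ne_zero _ one_ne_zero
  have hprob : IsProbabilityMeasure
      ((volume : Measure ℝ).withDensity fun x ↦ ENNReal.ofReal (gaussianPDFReal 0 1 x)) := by
    rw [← h1]; infer_instance
  -- One normalising factor `1 / √(2π)` per coordinate, moved into the exponent.
  refine ⟨Fintype.card ι • Real.log ((√(2 * Real.pi))⁻¹), ?_⟩
  rw [← map_pi_eq_stdGaussian, h1, pi_withDensity_ofReal
    (fun _ ↦ integrable_gaussianPDFReal 0 1) (fun _ ↦ gaussianPDFReal_nonneg 0 1)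
    fun _ ↦ inferInstance]
  have h2 := map_withDensity_of_equiv (MeasurableEquiv.toLp 2 (ι → ℝ)) volume
    (fun x : ι → ℝ ↦ ENNReal.ofReal (∏ i, gaussianPDFReal 0 1 (x i)))
  have h3 : (volume : Measure (ι → ℝ)).map (MeasurableEquiv.toLp 2 (ι → ℝ)) = volume :=
    (PiLp.volume_preserving_toLp ι).map_eq
  rw [h3] at h2
  refine h2.trans (congrArg _ ?_)
  ext x
  simp only [Function.comp_apply]
  rw [EuclideanSpace.real_norm_sq_eq, Finset.mul_sum, ← Finset.card_univ, ← Finset.sum_const,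
    ← Finset.sum_sub_distrib, Real.exp_sum]
  refine congrArg _ (Finset.prod_congr rfl fun i _ ↦ ?_)
  rw [Real.exp_sub, Real.exp_log (by positivity), div_eq_mul_inv, ← Real.exp_neg, gaussianPDFReal]
  simp only [NNReal.coe_one, mul_one, sub_zero, MeasurableEquiv.toLp_symm_apply]
  ring_nf

open scoped MatrixOrder Matrix.Norms.L2Operator in
/-- A Gaussian law whose nonzero linear marginals are nondegenerate has a density of the form
`exp (c - ‖T (x - m)‖²)`. -/
lemma gaussian_eq_withDensity {G : Measure (EuclideanSpace ℝ ι)} [IsGaussian G]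
    (hG : ∀ ℓ : StrongDual ℝ (EuclideanSpace ℝ ι), ℓ ≠ 0 → Var[ℓ; G] ≠ 0) :
    ∃ (c : ℝ) (T : EuclideanSpace ℝ ι →L[ℝ] EuclideanSpace ℝ ι),
      G = volume.withDensity fun x ↦
        ENNReal.ofReal (Real.exp (c - ‖T (x - ∫ z, z ∂G)‖ ^ 2)) := by
  classical
  have hL2 : MemLp id 2 G := IsGaussian.memLp_two_id
  have hX (i : ι) : MemLp (fun z : EuclideanSpace ℝ ι ↦ z i) 2 G :=
    memLp_clm hL2 (EuclideanSpace.proj i : EuclideanSpace ℝ ι →L[ℝ] ℝ)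
  have hS : (covMatrix G).PosDef := by
    refine Matrix.PosDef.of_dotProduct_mulVec_pos (isHermitian_covariance G _) fun x hx ↦ ?_
    rw [covMatrix, dotProduct_covariance_mulVec hX]
    refine lt_of_le_of_ne (variance_nonneg _ _) (Ne.symm ?_)
    have h1 := hG (∑ i, x i • (EuclideanSpace.proj i : StrongDual ℝ (EuclideanSpace ℝ ι))) fun h ↦ by
      refine hx (funext fun i ↦ ?_)
      simpa using congrArg (fun ℓ : StrongDual ℝ (EuclideanSpace ℝ ι) ↦
        ℓ (EuclideanSpace.single i 1)) h
    convert h1 using 2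
    ext z
    simp
  have hGS : G = multivariateGaussian (∫ z, z ∂G) (covMatrix G) :=
    (ext_of_sameCov (sameCov_multivariateGaussian hL2 _) integral_id_multivariateGaussian).symm
  set m := ∫ z, z ∂G
  have hunit : IsUnit (Matrix.toEuclideanCLM (n := ι) (𝕜 := ℝ) (CFC.sqrt (covMatrix G))) :=
    ((CFC.isUnit_sqrt_iff _ hS.posSemidef.nonneg).2 hS.isUnit).map _
  obtain ⟨u, hu⟩ := hunit
  let e : EuclideanSpace ℝ ι ≃L[ℝ] EuclideanSpace ℝ ι := ContinuousLinearEquiv.unitsEquiv ℝ _ u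
  have he (x) : e x = Matrix.toEuclideanCLM (n := ι) (𝕜 := ℝ) (CFC.sqrt (covMatrix G)) x := by
    rw [← hu]; rfl
  let g : EuclideanSpace ℝ ι ≃ᵐ EuclideanSpace ℝ ι :=
    e.toHomeomorph.toMeasurableEquiv.trans (Homeomorph.addLeft m).toMeasurableEquiv
  have hg (x) : g x = m + e x := rfl
  have hgs (x) : g.symm x = e.symm (x - m) := by
    rw [MeasurableEquiv.symm_apply_eq, hg]
    simp
  obtain ⟨c, hc⟩ := stdGaussian_eq_withDensity (ι := ι)
  have hdet : LinearMap.det (e : EuclideanSpace ℝ ι →ₗ[ℝ] EuclideanSpace ℝ ι) ≠ 0 :=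
    e.toLinearEquiv.isUnit_det'.ne_zero
  set K : ℝ := |(LinearMap.det (e : EuclideanSpace ℝ ι →ₗ[ℝ] EuclideanSpace ℝ ι))⁻¹| with hK
  have hKpos : 0 < K := abs_pos.2 (inv_ne_zero hdet)
  have hvol : (volume : Measure (EuclideanSpace ℝ ι)).map g = ENNReal.ofReal K • volume := by
    have h1 := Measure.map_linearMap_addHaar_eq_smul_addHaar
      (volume : Measure (EuclideanSpace ℝ ι)) hdet
    have h2 : (g : EuclideanSpace ℝ ι → EuclideanSpace ℝ ι) = (fun x ↦ m + x) ∘ e := rfl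
    rw [h2, ← Measure.map_map (by fun_prop) (by fun_prop)]
    erw [h1]
    rw [Measure.map_smul, map_add_left_eq_self]
  have hGmap : G = (stdGaussian (EuclideanSpace ℝ ι)).map g := by
    rw [hGS, multivariateGaussian]
    congr 1
    ext1 x
    rw [hg, he]
  -- `G` is the image of the standard Gaussian under `z ↦ m + √Σ z`: the Jacobian contributes `log
  -- K`, and `T = Σ^(-1/2) / √2` absorbs the factor `1/2`.
  refine ⟨Real.log K + c, (√2)⁻¹ • (e.symm : EuclideanSpace ℝ ι →L[ℝ] EuclideanSpace ℝ ι), ?_⟩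
  rw [hGmap, hc, map_withDensity_of_equiv, hvol, withDensity_smul_measure,
    ← withDensity_smul _ (by fun_prop)]
  congr 1
  ext x
  simp only [Pi.smul_apply, Function.comp_apply, hgs, smul_eq_mul]
  rw [← ENNReal.ofReal_mul hKpos.le, add_sub_assoc, Real.exp_add, Real.exp_log hKpos]
  simp [norm_smul, mul_pow]

end Density

/-! ### Linear least-squares estimation -/

section Estimator

open scoped RealInnerProductSpace

variable {E : Type*} [NormedAddCommGroup E] [InnerProductSpace ℝ E] [FiniteDimensional ℝ E]

/-- A linear map whose values are orthogonal to the kernel of a symmetric map factors through it. -/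
lemma exists_comp_eq_of_orthogonal_ker {K M : E →ₗ[ℝ] E} (hK : K.IsSymmetric)
    (h : ∀ u v, K u = 0 → ⟪M v, u⟫ = 0) : ∃ A : E →ₗ[ℝ] E, K ∘ₗ A = M := by
  have hr (v : E) : M v ∈ K.range := by
    have h1 : K.kerᗮ = K.range := by
      rw [LinearMap.orthogonal_ker, hK.adjoint_eq]
    rw [← h1, Submodule.mem_orthogonal']
    exact fun u hu ↦ h u v hu
  obtain ⟨A, hA⟩ := Module.projective_lifting_property K.rangeRestrict (M.codRestrict K.range hr)
    K.surjective_rangeRestrict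
  refine ⟨A, LinearMap.ext fun v ↦ ?_⟩
  simpa using congrArg Subtype.val (LinearMap.congr_fun hA v)

lemma covariance_eq_zero_of_variance_eq_zero {Ω : Type*} [MeasurableSpace Ω] {P : Measure Ω}
    [IsFiniteMeasure P] {X Y : Ω → ℝ} (hY : MemLp Y 2 P) (h : Var[Y; P] = 0) :
    cov[X, Y; P] = 0 := by
  have h1 := ae_eq_integral_of_variance_eq_zero hY h
  rw [covariance]
  refine integral_eq_zero_of_ae ?_
  filter_upwards [h1] with ω hω
  simp [hω]

variable [MeasurableSpace E] [BorelSpace E]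

/-- The linear least-squares estimator: `X - A Y` is uncorrelated with `Y`. -/
lemma exists_linear_estimator {π : Measure (E × E)} [IsProbabilityMeasure π]
    (hπ : MemLp id 2 π) : ∃ A : E →L[ℝ] E, ∀ ℓ ℓ' : StrongDual ℝ E,
      cov[fun z ↦ ℓ (z.1 - A z.2), fun z ↦ ℓ' z.2; π] = 0 := by
  -- `p u` and `q v` are the functionals `⟪u, X⟫` and `⟪v, Y⟫`; below, `K` is the covariance
  -- operator of `Y` and `M` the cross-covariance, and the normal equations read `K ∘ A = M`.
  let p : E →L[ℝ] StrongDual ℝ (E × E) :=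
    ((ContinuousLinearMap.compL ℝ (E × E) E ℝ).flip (ContinuousLinearMap.fst ℝ E E)).comp (innerSL ℝ)
  let q : E →L[ℝ] StrongDual ℝ (E × E) :=
    ((ContinuousLinearMap.compL ℝ (E × E) E ℝ).flip (ContinuousLinearMap.snd ℝ E E)).comp (innerSL ℝ)
  have hcov (ℓ ℓ' : StrongDual ℝ (E × E)) : covarianceBilinDual π ℓ ℓ' = cov[ℓ, ℓ'; π] :=
    covarianceBilinDual_eq_covariance hπ ℓ ℓ'
  let K : E →L[ℝ] E := InnerProductSpace.continuousLinearMapOfBilin (𝕜 := ℝ)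
    ((covarianceBilinDual π).bilinearComp q q)
  let M : E →L[ℝ] E := InnerProductSpace.continuousLinearMapOfBilin (𝕜 := ℝ)
    ((covarianceBilinDual π).bilinearComp p q)
  have hK (u v : E) : ⟪K u, v⟫ = covarianceBilinDual π (q u) (q v) :=
    InnerProductSpace.continuousLinearMapOfBilin_apply _ u v
  have hM (u v : E) : ⟪M u, v⟫ = covarianceBilinDual π (p u) (q v) :=
    InnerProductSpace.continuousLinearMapOfBilin_apply _ u v
  have hsymm : (K : E →ₗ[ℝ] E).IsSymmetric := fun u v ↦ by
    simp only [ContinuousLinearMap.coe_coe]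
    rw [hK, real_inner_comm, hK, covarianceBilinDual_comm]
  -- `K` may be singular, but `K u = 0` makes `⟪u, Y⟫` almost surely constant, hence uncorrelated
  -- with `X`; so the equations are solvable.
  obtain ⟨A, hA⟩ := exists_comp_eq_of_orthogonal_ker (K := (K : E →ₗ[ℝ] E))
      (M := (M : E →ₗ[ℝ] E)) hsymm fun u v hu ↦ by
    have h1 : covarianceBilinDual π (q u) (q u) = 0 := by
      rw [← hK, show K u = 0 from hu, inner_zero_left]
    rw [covarianceBilinDual_self_eq_variance hπ] at h1
    change ⟪M v, u⟫ = 0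
    rw [hM, hcov]
    exact covariance_eq_zero_of_variance_eq_zero (memLp_clm hπ _) h1
  let A' : E →L[ℝ] E := ContinuousLinearMap.adjoint A.toContinuousLinearMap
  refine ⟨A', fun ℓ ℓ' ↦ ?_⟩
  set u := (InnerProductSpace.toDual ℝ E).symm ℓ
  set v := (InnerProductSpace.toDual ℝ E).symm ℓ'
  have h1 : (fun z : E × E ↦ ℓ (z.1 - A' z.2)) = (p u - q (A u) : StrongDual ℝ (E × E)) := by
    ext z
    have : ⟪u, A' z.2⟫ = ⟪A u, z.2⟫ := ContinuousLinearMap.adjoint_inner_right _ _ _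
    rw [← InnerProductSpace.toDual_symm_apply, inner_sub_right, this]
    rfl
  have h2 : (fun z : E × E ↦ ℓ' z.2) = (q v : StrongDual ℝ (E × E)) := by
    ext z
    rw [← InnerProductSpace.toDual_symm_apply]
    rfl
  rw [h1, h2, ← hcov, map_sub, sub_apply, ← hK, ← hM, sub_eq_zero]
  exact congrArg (⟪·, v⟫) (LinearMap.congr_fun hA u).symm

end Estimator

/-! ### Density ratios of shifted laws -/

section Densities

variable {E : Type*} [NormedAddCommGroup E] [NormedSpace ℝ E] [FiniteDimensional ℝ E]
  [MeasurableSpace E] [BorelSpace E]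

/-- The law of `(W + A Y + b, Y)` for independent `W` and `Y`, relative to a product law. -/
lemma map_add_prod_eq_withDensity {lam μ N ν : Measure E} [lam.IsAddHaarMeasure]
    [SFinite μ] [SFinite N] [SFinite ν] {p q : E → ℝ} (hp : Measurable p) (hq : Measurable q)
    (hμ : μ = lam.withDensity fun x ↦ ENNReal.ofReal (Real.exp (p x)))
    (hN : N = lam.withDensity fun x ↦ ENNReal.ofReal (Real.exp (q x))) (A : E →L[ℝ] E) (b : E) :
    (N.prod ν).map (fun z ↦ (z.1 + (A z.2 + b), z.2))
      = (μ.prod ν).withDensity fun z ↦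
        ENNReal.ofReal (Real.exp (q (z.1 - (A z.2 + b)) - p z.1)) := by
  refine Measure.ext_of_lintegral _ fun g hg ↦ ?_
  rw [lintegral_map hg (by fun_prop), lintegral_prod_symm' _ (by fun_prop),
    lintegral_withDensity_eq_lintegral_mul _ (by fun_prop) hg, lintegral_prod_symm' _ (by fun_prop)]
  refine lintegral_congr fun y ↦ ?_
  -- With `y` fixed, `x` is translated by `A y + b`, under which `lam` is invariant; `ν` needs no
  -- density.
  rw [hN, hμ, lintegral_withDensity_eq_lintegral_mul _ (by fun_prop) (by fun_prop),
    lintegral_withDensity_eq_lintegral_mul _ (by fun_prop) (by fun_prop),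
    ← lintegral_sub_right_eq_self _ (A y + b)]
  refine lintegral_congr fun x ↦ ?_
  simp only [Pi.mul_apply, sub_add_cancel]
  rw [← mul_assoc, ← ENNReal.ofReal_mul (Real.exp_pos _).le, ← Real.exp_add]
  ring_nf

omit [NormedSpace ℝ E] [FiniteDimensional ℝ E] in
lemma map_add_eq_withDensity {lam μ N : Measure E} [lam.IsAddHaarMeasure]
    {p q : E → ℝ} (hp : Measurable p) (hq : Measurable q)
    (hμ : μ = lam.withDensity fun x ↦ ENNReal.ofReal (Real.exp (p x)))
    (hN : N = lam.withDensity fun x ↦ ENNReal.ofReal (Real.exp (q x))) (b : E) :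
    N.map (fun x ↦ x + b)
      = μ.withDensity fun x ↦ ENNReal.ofReal (Real.exp (q (x - b) - p x)) := by
  refine Measure.ext_of_lintegral _ fun g hg ↦ ?_
  rw [lintegral_map hg (by fun_prop), lintegral_withDensity_eq_lintegral_mul _ (by fun_prop) hg,
    hN, hμ, lintegral_withDensity_eq_lintegral_mul _ (by fun_prop) (by fun_prop),
    lintegral_withDensity_eq_lintegral_mul _ (by fun_prop) (by fun_prop),
    ← lintegral_sub_right_eq_self _ b]
  refine lintegral_congr fun x ↦ ?_
  simp only [Pi.mul_apply, sub_add_cancel]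
  rw [← mul_assoc, ← ENNReal.ofReal_mul (Real.exp_pos _).le, ← Real.exp_add]
  ring_nf

lemma lintegral_eq_one_of_withDensity {α : Type*} [MeasurableSpace α] {ρ τ : Measure α}
    [IsProbabilityMeasure τ] {f : α → ℝ≥0∞} (h : τ = ρ.withDensity f) : ∫⁻ x, f x ∂ρ = 1 := by
  rw [← setLIntegral_univ, ← withDensity_apply _ MeasurableSet.univ, ← h, measure_univ]

omit [FiniteDimensional ℝ E] in
/-- A hyperplane transverse to a nondegenerate direction is negligible. -/
lemma gaussian_hyperplane_eq_zero {μ : Measure E} [IsGaussian μ] {ℓ : StrongDual ℝ E}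
    (h : Var[ℓ; μ] ≠ 0) (c : ℝ) : μ {x | ℓ x = c} = 0 := by
  have h1 : μ {x | ℓ x = c} = μ.map ℓ {c} := by
    rw [Measure.map_apply (by fun_prop) (measurableSet_singleton c)]
    rfl
  rw [h1, IsGaussian.map_eq_gaussianReal]
  have h2 : Var[ℓ; μ].toNNReal ≠ 0 := by
    simpa using lt_of_le_of_ne (variance_nonneg _ _) h.symm
  have := nullSingletonClass_gaussianReal (μ := ∫ x, ℓ x ∂μ) h2
  exact measure_singleton c

end Densities

/-! ### Extremality of Gaussian laws for divergence and mutual information -/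

section Inequalities

variable {ι : Type*} [Fintype ι]

local notation "𝔼" => EuclideanSpace ℝ ι

lemma SameCov.variance_eq {E : Type*} [NormedAddCommGroup E] [NormedSpace ℝ E]
    [MeasurableSpace E] [BorelSpace E] {π π' : Measure E} (h : SameCov π π')
    (ℓ : StrongDual ℝ E) : Var[ℓ; π] = Var[ℓ; π'] := by
  have := h ℓ ℓ
  rwa [covariance_self (by fun_prop), covariance_self (by fun_prop)] at this

lemma klDiv_eq_top_of_null {α : Type*} [MeasurableSpace α] {π ρ : Measure α}
    [IsProbabilityMeasure π] {s : Set α} (hs : MeasurableSet s) (h1 : ∀ᵐ x ∂π, x ∈ s)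
    (h0 : ρ s = 0) : klDiv π ρ = ∞ := by
  refine klDiv_of_not_ac fun hac ↦ ?_
  have h2 : π s = 1 := (prob_compl_eq_zero_iff hs).1 h1
  rw [hac h0] at h2
  exact zero_ne_one h2

lemma integrable_const_sub_add {α : Type*} [MeasurableSpace α] {ρ : Measure α}
    [IsProbabilityMeasure ρ] {f g : α → ℝ} (hf : Integrable f ρ) (hg : Integrable g ρ) (c : ℝ) :
    Integrable (fun x ↦ c - f x + g x) ρ ∧
      ∫ x, (c - f x + g x) ∂ρ = c - ∫ x, f x ∂ρ + ∫ x, g x ∂ρ := by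
  have h1 : Integrable (fun x ↦ c - f x) ρ := (integrable_const c).sub hf
  refine ⟨h1.add hg, ?_⟩
  rw [integral_add h1 hg, integral_sub (integrable_const c) hf]
  simp

/-- Among laws with given covariance, and mean either preserved or moved to the mean of the
Gaussian reference, the Gaussian law has the least divergence from that reference. -/
theorem klDiv_gaussian_le {μ ν G : Measure 𝔼} [IsGaussian μ] [IsProbabilityMeasure ν]
    [IsGaussian G] (hμ : ∀ ℓ : StrongDual ℝ 𝔼, ℓ ≠ 0 → Var[ℓ; μ] ≠ 0) (hν : MemLp id 2 ν)
    (h : SameCov G ν) (hm : ∫ x, x ∂G = ∫ x, x ∂ν ∨ ∫ x, x ∂G = ∫ x, x ∂μ) :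
    klDiv G μ ≤ klDiv ν μ := by
  by_cases hG : ∀ ℓ : StrongDual ℝ 𝔼, ℓ ≠ 0 → Var[ℓ; G] ≠ 0
  · have hG2 : MemLp id 2 G := IsGaussian.memLp_two_id
    obtain ⟨c, T, hT⟩ := gaussian_eq_withDensity hG
    obtain ⟨c', T', hT'⟩ := gaussian_eq_withDensity hμ
    set m := ∫ x, x ∂G
    set m' := ∫ x, x ∂μ
    set mν := ∫ x, x ∂ν
    have hd := map_add_eq_withDensity (p := fun x ↦ c' - ‖T' (x - m')‖ ^ 2)
      (q := fun x ↦ c - ‖T (x - m)‖ ^ 2) (by fun_prop) (by fun_prop) hT' hT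
    have hint (ρ : Measure 𝔼) [IsProbabilityMeasure ρ] (hρ : MemLp id 2 ρ) (b : 𝔼) :
        Integrable (fun x ↦ c - ‖T (x - b - m)‖ ^ 2 - (c' - ‖T' (x - m')‖ ^ 2)) ρ ∧
        ∫ x, (c - ‖T (x - b - m)‖ ^ 2 - (c' - ‖T' (x - m')‖ ^ 2)) ∂ρ
          = c - c' - ∫ x, ‖T x - T (b + m)‖ ^ 2 ∂ρ + ∫ x, ‖T' x - T' m'‖ ^ 2 ∂ρ := by
      have e : (fun x ↦ c - ‖T (x - b - m)‖ ^ 2 - (c' - ‖T' (x - m')‖ ^ 2))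
          = fun x ↦ c - c' - ‖T x - T (b + m)‖ ^ 2 + ‖T' x - T' m'‖ ^ 2 := by
        ext x
        rw [sub_sub x, map_sub, map_sub]
        ring
      have i1 := integrable_norm_sq_sub hρ T (T (b + m))
      have i2 := integrable_norm_sq_sub hρ T' (T' m')
      rw [e]
      exact integrable_const_sub_add i1 i2 _
    have hd0 := hd 0
    obtain ⟨hi0, e0⟩ := hint G hG2 0
    simp only [add_zero, Measure.map_id', sub_zero, zero_add] at hd0 hi0 e0
    have h1 := klDiv_withDensity_exp (by fun_prop) hd0 hi0
    -- The test density is that of `G` translated to the mean of `ν`, so that the `T`-terms have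
    -- equal expectations under `G` and `ν`.
    have hprob : IsProbabilityMeasure (G.map fun x ↦ x + (mν - m)) :=
      Measure.isProbabilityMeasure_map (by fun_prop)
    refine h1.le.trans (le_trans ?_ (ofReal_integral_le_klDiv (by fun_prop)
      (lintegral_eq_one_of_withDensity (hd (mν - m))) (hint ν hν _).1))
    refine ENNReal.ofReal_le_ofReal ?_
    rw [e0, (hint ν hν _).2, sub_add_cancel]
    have e1 := integral_norm_sq_sub_eq_of_sameCov hG2 hν h T (T m) (T mν)
    have e2 := integral_norm_sq_sub_eq_of_sameCov hG2 hν h T' (T' m') (T' m')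
    simp only [sub_self, norm_zero, m, mν] at e1
    -- Only this bias term depends on the choice of mean; it vanishes when `G` is centred at the
    -- mean of `μ`.
    have e3 : ‖T' m - T' m'‖ ^ 2 ≤ ‖T' mν - T' m'‖ ^ 2 := by
      rcases hm with hm | hm
      · rw [hm]
      · rw [hm]
        simp
    linarith
  -- A degenerate direction of `G` is degenerate for `ν`, which then sits on a `μ`-null hyperplane.
  · push Not at hG
    obtain ⟨ℓ, hℓ, hv⟩ := hG
    rw [h.variance_eq] at hv
    have h1 := ae_eq_integral_of_variance_eq_zero (memLp_clm hν ℓ) hv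
    rw [klDiv_eq_top_of_null (s := {x | ℓ x = ∫ x, ℓ x ∂ν})
      (measurableSet_eq_fun (by fun_prop) (by fun_prop)) h1
      (gaussian_hyperplane_eq_zero (hμ ℓ hℓ) _)]
    exact le_top

/-- Among joint laws with given Gaussian first marginal and given covariance, the Gaussian one has
the least mutual information. -/
theorem klDiv_prod_gaussian_le {π πG : Measure (𝔼 × 𝔼)} [IsProbabilityMeasure π]
    [IsGaussian πG] (hπ : MemLp id 2 π) (h : SameCov πG π)
    (hfst : πG.map Prod.fst = π.map Prod.fst)
    (hμ : ∀ ℓ : StrongDual ℝ 𝔼, ℓ ≠ 0 → Var[ℓ; πG.map Prod.fst] ≠ 0) :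
    klDiv πG ((πG.map Prod.fst).prod (πG.map Prod.snd))
      ≤ klDiv π ((π.map Prod.fst).prod (π.map Prod.snd)) := by
  have hG2 : MemLp id 2 πG := IsGaussian.memLp_two_id
  obtain ⟨A, hA⟩ := exists_linear_estimator hG2
  let W : 𝔼 × 𝔼 →L[ℝ] 𝔼 := .fst ℝ 𝔼 𝔼 - A.comp (.snd ℝ 𝔼 𝔼)
  have hW (z) : W z = z.1 - A z.2 := rfl
  have hμG : IsGaussian (πG.map Prod.fst) :=
    inferInstanceAs (IsGaussian (πG.map (ContinuousLinearMap.fst ℝ 𝔼 𝔼)))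
  have hνG : IsGaussian (πG.map Prod.snd) :=
    inferInstanceAs (IsGaussian (πG.map (ContinuousLinearMap.snd ℝ 𝔼 𝔼)))
  have hν : IsProbabilityMeasure (π.map Prod.snd) :=
    Measure.isProbabilityMeasure_map (by fun_prop)
  rw [← hfst]
  by_cases hN : ∀ ℓ : StrongDual ℝ 𝔼, ℓ ≠ 0 → Var[ℓ; πG.map W] ≠ 0
  · obtain ⟨c, T, hT⟩ := gaussian_eq_withDensity hN
    obtain ⟨c', T', hT'⟩ := gaussian_eq_withDensity hμ
    have hmW : ∫ x, x ∂(πG.map W) = W (∫ z, z ∂πG) :=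
      ContinuousLinearMap.integral_id_map IsGaussian.integrable_id _
    rw [hmW] at hT
    set m := W (∫ z, z ∂πG) with hm
    set m' := ∫ x, x ∂(πG.map Prod.fst)
    set mπ := W (∫ z, z ∂π) with hmπ
    -- The same density ratio serves for every second marginal: for that of `πG` it gives the exact
    -- value, for that of `π` a lower bound.
    have hd (ν : Measure 𝔼) [IsProbabilityMeasure ν] (b : 𝔼) :=
      map_add_prod_eq_withDensity (ν := ν) (p := fun x ↦ c' - ‖T' (x - m')‖ ^ 2)
        (q := fun x ↦ c - ‖T (x - m)‖ ^ 2) (by fun_prop) (by fun_prop) hT' hT A b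
    have hint (ρ : Measure (𝔼 × 𝔼)) [IsProbabilityMeasure ρ] (hρ : MemLp id 2 ρ) (b : 𝔼) :
        Integrable (fun z : 𝔼 × 𝔼 ↦
          c - ‖T (z.1 - (A z.2 + b) - m)‖ ^ 2 - (c' - ‖T' (z.1 - m')‖ ^ 2)) ρ ∧
        ∫ z, (c - ‖T (z.1 - (A z.2 + b) - m)‖ ^ 2 - (c' - ‖T' (z.1 - m')‖ ^ 2)) ∂ρ
          = c - c' - ∫ z, ‖(T.comp W) z - T (b + m)‖ ^ 2 ∂ρ
            + ∫ z, ‖(T'.comp (.fst ℝ 𝔼 𝔼)) z - T' m'‖ ^ 2 ∂ρ := by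
      have e : (fun z : 𝔼 × 𝔼 ↦
            c - ‖T (z.1 - (A z.2 + b) - m)‖ ^ 2 - (c' - ‖T' (z.1 - m')‖ ^ 2))
          = fun z ↦ c - c' - ‖(T.comp W) z - T (b + m)‖ ^ 2
            + ‖(T'.comp (.fst ℝ 𝔼 𝔼)) z - T' m'‖ ^ 2 := by
        ext z
        have e1 : z.1 - (A z.2 + b) - m = W z - (b + m) := by rw [hW]; abel
        rw [e1, map_sub, map_sub]
        simp only [ContinuousLinearMap.comp_apply, ContinuousLinearMap.coe_fst']
        ring
      have i1 := integrable_norm_sq_sub hρ (T.comp W) (T (b + m))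
      have i2 := integrable_norm_sq_sub hρ (T'.comp (.fst ℝ 𝔼 𝔼)) (T' m')
      rw [e]
      exact integrable_const_sub_add i1 i2 _
    -- For jointly Gaussian vectors, uncorrelated implies independent.
    have hind : IndepFun W Prod.snd πG := by
      refine HasGaussianLaw.indepFun_of_covariance_strongDual ⟨?_⟩ hA
      exact inferInstanceAs (IsGaussian (πG.map (W.prod (.snd ℝ 𝔼 𝔼))))
    have hpush : πG = ((πG.map W).prod (πG.map Prod.snd)).map
        (fun z ↦ (z.1 + (A z.2 + 0), z.2)) := by
      rw [← (indepFun_iff_map_prod_eq_prod_map_map (by fun_prop) (by fun_prop)).1 hind,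
        Measure.map_map (by fun_prop) (by fun_prop)]
      conv_lhs => rw [← Measure.map_id (μ := πG)]
      congr 1
      ext z <;> simp [hW]
    have h1 : klDiv πG _ = _ := klDiv_withDensity_exp (by fun_prop)
      (hpush.trans (hd (πG.map Prod.snd) 0)) (hint πG hG2 0).1
    -- The shift `mπ - m` gives the Gaussian error the mean that `W` has under `π`.
    have hprob : IsProbabilityMeasure (((πG.map W).prod (π.map Prod.snd)).map
        (fun z ↦ (z.1 + (A z.2 + (mπ - m)), z.2))) :=
      Measure.isProbabilityMeasure_map (by fun_prop)
    refine h1.le.trans (le_trans ?_ (ofReal_integral_le_klDiv (by fun_prop)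
      (lintegral_eq_one_of_withDensity (hd (π.map Prod.snd) (mπ - m))) (hint π hπ _).1))
    refine ENNReal.ofReal_le_ofReal (le_of_eq ?_)
    rw [(hint πG hG2 0).2, (hint π hπ _).2, sub_add_cancel, zero_add]
    have e1 := integral_norm_sq_sub_eq_of_sameCov hG2 hπ h (T.comp W) (T m) (T mπ)
    simp only [ContinuousLinearMap.comp_apply, ← hm, ← hmπ, sub_self, norm_zero] at e1
    have e2 : ∫ z, ‖(T'.comp (.fst ℝ 𝔼 𝔼)) z - T' m'‖ ^ 2 ∂πG
        = ∫ z, ‖(T'.comp (.fst ℝ 𝔼 𝔼)) z - T' m'‖ ^ 2 ∂π := by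
      have e3 (ρ : Measure (𝔼 × 𝔼)) : ∫ z, ‖(T'.comp (.fst ℝ 𝔼 𝔼)) z - T' m'‖ ^ 2 ∂ρ
          = ∫ x, ‖T' x - T' m'‖ ^ 2 ∂(ρ.map Prod.fst) := by
        rw [integral_map (by fun_prop) (by fun_prop)]
        rfl
      rw [e3, e3, hfst]
    rw [e2]
    simp only [ContinuousLinearMap.comp_apply] at e1 ⊢
    linarith
  · push Not at hN
    obtain ⟨ℓ, hℓ, hv⟩ := hN
    rw [(h.map W).variance_eq, variance_map (by fun_prop) (by fun_prop)] at hv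
    have h1 := ae_eq_integral_of_variance_eq_zero (memLp_clm hπ (ℓ.comp W)) hv
    rw [klDiv_eq_top_of_null (s := {z | ℓ (W z) = ∫ z, ℓ (W z) ∂π})
      (measurableSet_eq_fun (by fun_prop) (by fun_prop)) h1 ?_]
    · exact le_top
    · rw [Measure.prod_apply_symm (measurableSet_eq_fun (by fun_prop) (by fun_prop))]
      refine (lintegral_eq_zero_iff' ?_).2 (ae_of_all _ fun y ↦ ?_)
      · exact (measurable_measure_prodMk_right
          (measurableSet_eq_fun (by fun_prop) (by fun_prop))).aemeasurable
      -- For fixed `y` the slice is the hyperplane `ℓ x = const + ℓ (A y)`, null for `μ`.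
      · refine (congrArg _ ?_).trans
          (gaussian_hyperplane_eq_zero (hμ ℓ hℓ) (∫ z, ℓ (W z) ∂π + ℓ (A y)))
        ext x
        simp [hW, sub_eq_iff_eq_add]

end Inequalities

/-! ### Gaussian replacement of couplings -/

section Couplings

variable {E : Type*} [NormedAddCommGroup E] [InnerProductSpace ℝ E] [FiniteDimensional ℝ E]
  [MeasurableSpace E] [BorelSpace E]

/-- The quadratic transport cost of a coupling. -/
noncomputable def quadraticCost (γ : Measure (E × E)) : ℝ≥0∞ :=
  ∫⁻ z, ‖z.1 - z.2‖ₑ ^ 2 ∂γ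

/-- `Y = X - (X - Y)` is a difference of square-integrable vectors; thus finite distortion alone
gives `X̂` second moments. -/
lemma memLp_id_of_quadraticCost_ne_top {γ : Measure (E × E)}
    (hfst : MemLp id 2 (γ.map Prod.fst)) (hcost : quadraticCost γ ≠ ∞) : MemLp id 2 γ := by
  have h1 : MemLp (fun z : E × E ↦ z.1) 2 γ :=
    (memLp_map_measure_iff (f := Prod.fst) (g := id) (by fun_prop) (by fun_prop)).1 hfst
  have h2 : MemLp (fun z : E × E ↦ z.1 - z.2) 2 γ := by
    refine ⟨by fun_prop, ?_⟩
    rw [eLpNorm_lt_top_iff_lintegral_rpow_enorm_lt_top (by simp) (by simp)]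
    simpa [quadraticCost, lt_top_iff_ne_top] using hcost
  have h3 : MemLp (fun z : E × E ↦ z.2) 2 γ := by
    convert h1.sub h2 using 1
    ext z
    simp
  exact memLp_prod_iff.2 ⟨h1, h3⟩

omit [FiniteDimensional ℝ E] [BorelSpace E] in
lemma quadraticCost_eq_ofReal {γ : Measure (E × E)} [IsProbabilityMeasure γ]
    (h : MemLp id 2 γ) : quadraticCost γ = ENNReal.ofReal
      (∫ z, ‖(ContinuousLinearMap.fst ℝ E E - .snd ℝ E E) z - 0‖ ^ 2 ∂γ) := by
  rw [ofReal_integral_eq_lintegral_ofReal (integrable_norm_sq_sub h _ _)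
    (ae_of_all _ fun z ↦ by positivity)]
  refine lintegral_congr fun z ↦ ?_
  rw [ENNReal.ofReal_pow (norm_nonneg _), ofReal_norm]
  simp

variable {ι : Type*} [Fintype ι]

local notation "𝔼" => EuclideanSpace ℝ ι

/-- A coupling with a centered Gaussian law can be replaced by a Gaussian coupling with the same
covariance, preserving or removing the mean of the second marginal, at no larger cost. -/
lemma exists_gaussian_coupling {μ : Measure 𝔼} [IsGaussian μ] (hμ : ∫ x, x ∂μ = 0)
    {γ : Measure (𝔼 × 𝔼)} (hfst : γ.map Prod.fst = μ) (hcost : quadraticCost γ ≠ ∞) {m : 𝔼}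
    (hm : m = ∫ y, y ∂(γ.map Prod.snd) ∨ m = 0) :
    MemLp id 2 γ ∧ ∃ γ' : Measure (𝔼 × 𝔼), IsGaussian γ' ∧ γ'.map Prod.fst = μ ∧
      ∫ y, y ∂(γ'.map Prod.snd) = m ∧ SameCov γ' γ ∧ quadraticCost γ' ≤ quadraticCost γ := by
  have hprob : IsProbabilityMeasure γ := by
    have : IsProbabilityMeasure (γ.map Prod.fst) := hfst ▸ inferInstance
    exact (Measure.isProbabilityMeasure_map_iff (by fun_prop)).1 this
  have hγ : MemLp id 2 γ :=
    memLp_id_of_quadraticCost_ne_top (hfst ▸ IsGaussian.memLp_two_id) hcost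
  have hmean1 (ρ : Measure (𝔼 × 𝔼)) (hρ : Integrable id ρ) :
      ∫ x, x ∂(ρ.map Prod.fst) = (∫ z, z ∂ρ).1 :=
    ContinuousLinearMap.integral_id_map hρ (.fst ℝ 𝔼 𝔼)
  have hmean2 (ρ : Measure (𝔼 × 𝔼)) (hρ : Integrable id ρ) :
      ∫ x, x ∂(ρ.map Prod.snd) = (∫ z, z ∂ρ).2 :=
    ContinuousLinearMap.integral_id_map hρ (.snd ℝ 𝔼 𝔼)
  obtain ⟨γ', hG, hγ'm, hcov⟩ := exists_gaussian_sameCov hγ (0, m)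
  have hγ' : MemLp id 2 γ' := IsGaussian.memLp_two_id
  refine ⟨hγ, γ', hG, ?_, ?_, hcov, ?_⟩
  · have hfG : IsGaussian (γ'.map Prod.fst) :=
      inferInstanceAs (IsGaussian (γ'.map (ContinuousLinearMap.fst ℝ 𝔼 𝔼)))
    refine ext_of_sameCov (hfst ▸ hcov.map (.fst ℝ 𝔼 𝔼)) ?_
    rw [hmean1 _ IsGaussian.integrable_id, hγ'm, hμ]
  · rw [hmean2 _ IsGaussian.integrable_id, hγ'm]
  · rw [quadraticCost_eq_ofReal hγ, quadraticCost_eq_ofReal hγ']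
    refine ENNReal.ofReal_le_ofReal ?_
    have h1 := integral_norm_sq_sub_eq_of_sameCov hγ' hγ hcov
      (ContinuousLinearMap.fst ℝ 𝔼 𝔼 - .snd ℝ 𝔼 𝔼) 0 0
    have hγi : Integrable id γ := hγ.integrable (by simp)
    have h2 : (∫ z, z ∂γ).1 = 0 := by rw [← hmean1 _ hγi, hfst, hμ]
    -- Since `μ` is centred, the mean part of the cost is the squared norm of the second mean, which
    -- is either kept or set to zero.
    have h3 : ‖(ContinuousLinearMap.fst ℝ 𝔼 𝔼 - .snd ℝ 𝔼 𝔼) (∫ z, z ∂γ') - 0‖ ^ 2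
        ≤ ‖(ContinuousLinearMap.fst ℝ 𝔼 𝔼 - .snd ℝ 𝔼 𝔼) (∫ z, z ∂γ) - 0‖ ^ 2 := by
      rw [hγ'm]
      simp only [sub_apply, ContinuousLinearMap.coe_fst', ContinuousLinearMap.coe_snd', h2,
        zero_sub, sub_zero, norm_neg]
      rw [← hmean2 _ hγi]
      rcases hm with hm | hm
      · rw [hm]
      · rw [hm]
        simp
    linarith

end Couplings

/-! ### Perception losses and reconstruction kernels -/

variable {L : ℕ}

/-- Each finite-cost coupling of `μ` and `ν` has a Gaussian replacement with second mean that of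
`G`; its second marginal also has the covariance of `G`, hence equals `G`. -/
lemma wassersteinSqLoss_gaussian_le {μ ν G : Measure (Vec L)} [IsGaussian μ] [IsGaussian G]
    (hμ : ∫ x, x ∂μ = 0) (h : SameCov G ν)
    (hm : ∫ x, x ∂G = ∫ x, x ∂ν ∨ ∫ x, x ∂G = 0) :
    wassersteinSqLoss μ G ≤ wassersteinSqLoss μ ν := by
  refine le_iInf₂ fun γ ⟨h1, h2⟩ ↦ ?_
  by_cases hcost : quadraticCost γ = ∞
  · exact le_top.trans_eq hcost.symm
  obtain ⟨-, γ', hG, hfst, hmean, hcov, hle⟩ :=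
    exists_gaussian_coupling hμ h1 hcost (m := ∫ x, x ∂G) (by rwa [h2])
  have hsG : IsGaussian (γ'.map Prod.snd) :=
    inferInstanceAs (IsGaussian (γ'.map (ContinuousLinearMap.snd ℝ (Vec L) (Vec L))))
  refine (iInf₂_le γ' ⟨hfst, ?_⟩).trans hle
  refine ext_of_sameCov (fun ℓ ℓ' ↦ ?_) hmean
  rw [h ℓ ℓ', ← h2]
  exact hcov.map (.snd ℝ _ _) ℓ ℓ'

lemma wassersteinSqLoss_self (μ : Measure (Vec L)) : wassersteinSqLoss μ μ = 0 := by
  have h1 : (μ.map fun x ↦ (x, x)).map Prod.fst = μ := by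
    rw [Measure.map_map (by fun_prop) (by fun_prop)]
    exact Measure.map_id
  have h2 : (μ.map fun x ↦ (x, x)).map Prod.snd = μ := by
    rw [Measure.map_map (by fun_prop) (by fun_prop)]
    exact Measure.map_id
  refine le_antisymm ((iInf₂_le _ ⟨h1, h2⟩).trans ?_) zero_le
  rw [lintegral_map (by fun_prop) (by fun_prop)]
  simp

lemma map_fst_jointLaw (μ : Measure (Vec L)) [SFinite μ] (κ : Kernel (Vec L) (Vec L))
    [IsMarkovKernel κ] : (jointLaw μ κ).map Prod.fst = μ :=
  Measure.fst_compProd μ κ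

lemma variance_multivariateGaussian_ne_zero {ι : Type*} [Fintype ι] [DecidableEq ι]
    {S : Matrix ι ι ℝ} (hS : S.PosDef) (m : EuclideanSpace ℝ ι)
    {ℓ : StrongDual ℝ (EuclideanSpace ℝ ι)} (hℓ : ℓ ≠ 0) :
    Var[ℓ; multivariateGaussian m S] ≠ 0 := by
  set x := (InnerProductSpace.toDual ℝ (EuclideanSpace ℝ ι)).symm ℓ with hx
  have hx0 : x ≠ 0 := by simpa [hx] using hℓ
  have h1 : ℓ = InnerProductSpace.toDual ℝ (EuclideanSpace ℝ ι) x := by simp [hx]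
  have h2 := covarianceBilin_self (μ := multivariateGaussian m S) IsGaussian.memLp_two_id x
  rw [covarianceBilin_multivariateGaussian hS.posSemidef] at h2
  have h3 := hS.dotProduct_mulVec_pos (x := x.ofLp) (by simpa using hx0)
  simp only [star_trivial] at h3
  rw [h2] at h3
  rw [h1]
  exact h3.ne'

/-- A reconstruction of finite distortion is dominated by a jointly Gaussian one with the same
covariances, and with the same or with zero mean. -/
lemma exists_jointlyGaussian_noWorse {μ : Measure (Vec L)} [IsGaussian μ]
    (hμ0 : ∫ x, x ∂μ = 0) (hμ : ∀ ℓ : StrongDual ℝ (Vec L), ℓ ≠ 0 → Var[ℓ; μ] ≠ 0)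
    {φ : Measure (Vec L) → Measure (Vec L) → ℝ≥0∞} (hφ : φ = klLoss ∨ φ = wassersteinSqLoss)
    {κ : Kernel (Vec L) (Vec L)} [IsMarkovKernel κ] (hκ : distortion μ κ ≠ ∞) {m : Vec L}
    (hm : m = reconMean μ κ ∨ m = 0) :
    ∃ κG : Kernel (Vec L) (Vec L), IsMarkovKernel κG ∧ IsJointlyGaussian μ κG ∧
      reconMean μ κG = m ∧ SameCov (jointLaw μ κG) (jointLaw μ κ) ∧ NoWorse φ μ κG κ := by
  have hfst := map_fst_jointLaw μ κ
  have hprob : IsProbabilityMeasure (jointLaw μ κ) := by unfold jointLaw; infer_instance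
  have hprob' : IsProbabilityMeasure (reconLaw μ κ) :=
    Measure.isProbabilityMeasure_map (by fun_prop)
  obtain ⟨hL2, γ, hG, hγfst, hγm, hcov, hcost⟩ := exists_gaussian_coupling hμ0 hfst hκ hm
  -- Disintegrating over the first marginal, which is still `μ`, turns the Gaussian coupling into a
  -- reconstruction kernel.
  have hjoint : jointLaw μ γ.condKernel = γ := by
    rw [jointLaw, ← hγfst]
    exact γ.disintegrate γ.condKernel
  have hsG : IsGaussian (γ.map Prod.snd) :=
    inferInstanceAs (IsGaussian (γ.map (ContinuousLinearMap.snd ℝ (Vec L) (Vec L))))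
  have hcov2 : SameCov (γ.map Prod.snd) (reconLaw μ κ) := hcov.map (.snd ℝ _ _)
  have hm' : ∫ y, y ∂(γ.map Prod.snd) = ∫ y, y ∂(reconLaw μ κ)
      ∨ ∫ y, y ∂(γ.map Prod.snd) = 0 := by rwa [hγm]
  refine ⟨γ.condKernel, inferInstance, ?_, ?_, ?_, ?_, ?_, ?_⟩
  · rwa [IsJointlyGaussian, hjoint]
  · rw [reconMean, reconLaw, hjoint, hγm]
  · rwa [hjoint]
  · have := klDiv_prod_gaussian_le hL2 hcov (hγfst.trans hfst.symm) (by rwa [hγfst])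
    rw [hγfst, hfst] at this
    rwa [mutualInformation, reconLaw, hjoint]
  · rw [distortion, hjoint]
    exact hcost
  · rw [reconLaw, hjoint]
    rcases hφ with rfl | rfl
    · exact klDiv_gaussian_le hμ (memLp_id_map hL2 (.snd ℝ _ _)) hcov2 (by rwa [hμ0])
    · exact wassersteinSqLoss_gaussian_le hμ0 hcov2 hm'

/-- The independent copy of the source is a reconstruction without information and with perfect
perception. -/
lemma exists_jointlyGaussian_independent {μ : Measure (Vec L)} [IsGaussian μ]
    (hμ0 : ∫ x, x ∂μ = 0) {φ : Measure (Vec L) → Measure (Vec L) → ℝ≥0∞}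
    (hφ : φ = klLoss ∨ φ = wassersteinSqLoss) :
    ∃ κG : Kernel (Vec L) (Vec L), IsMarkovKernel κG ∧ IsJointlyGaussian μ κG ∧
      reconMean μ κG = 0 ∧ mutualInformation μ κG = 0 ∧ φ μ (reconLaw μ κG) = 0 := by
  have hj : jointLaw μ (Kernel.const _ μ) = μ.prod μ := Measure.compProd_const
  have hr : reconLaw μ (Kernel.const _ μ) = μ := by
    rw [reconLaw, hj]
    exact Measure.snd_prod
  refine ⟨Kernel.const _ μ, inferInstance, ?_, ?_, ?_, ?_⟩
  · rw [IsJointlyGaussian, hj]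
    infer_instance
  · rw [reconMean, hr, hμ0]
  · rw [mutualInformation, hj, hr, klDiv_self]
  · rw [hr]
    rcases hφ with rfl | rfl
    · exact klDiv_self μ
    · exact wassersteinSqLoss_self μ

end RDP

/-! ### The main theorem -/

theorem theorem2 {L : ℕ} (S : Matrix (Fin L) (Fin L) ℝ) (hS : S.PosDef)
    (μ : Measure (RDP.Vec L)) (hμ : μ = multivariateGaussian 0 S)
    (φ : Measure (RDP.Vec L) → Measure (RDP.Vec L) → ℝ≥0∞)
    (hφ : φ = RDP.klLoss ∨ φ = RDP.wassersteinSqLoss) :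
    -- a jointly Gaussian reconstruction with the same first and second moments is no worse
    (∀ κ : Kernel (RDP.Vec L) (RDP.Vec L), IsMarkovKernel κ → RDP.distortion μ κ ≠ ∞ →
      ∃ κG : Kernel (RDP.Vec L) (RDP.Vec L), IsMarkovKernel κG ∧
        RDP.IsJointlyGaussian μ κG ∧
        RDP.reconMean μ κG = RDP.reconMean μ κ ∧
        RDP.reconCov μ κG = RDP.reconCov μ κ ∧
        RDP.crossCov μ κG = RDP.crossCov μ κ ∧
        RDP.NoWorse φ μ κG κ) ∧
    -- every reconstruction can be replaced by a zero-mean jointly Gaussian one that is no worse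
    (∀ κ : Kernel (RDP.Vec L) (RDP.Vec L), IsMarkovKernel κ →
      ∃ κG : Kernel (RDP.Vec L) (RDP.Vec L), IsMarkovKernel κG ∧
        RDP.IsJointlyGaussian μ κG ∧
        RDP.reconMean μ κG = 0 ∧
        RDP.NoWorse φ μ κG κ) ∧
    -- the restriction to such reconstructions leaves the optimal value unchanged
    (∀ D P : ℝ≥0∞,
      RDP.informationRDP φ μ D P =
        ⨅ κ ∈ {κ ∈ RDP.feasible φ μ D P |
            RDP.IsJointlyGaussian μ κ ∧ RDP.reconMean μ κ = 0},
          RDP.mutualInformation μ κ) := by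
  have hG : IsGaussian μ := hμ ▸ inferInstance
  have hμ0 : ∫ x, x ∂μ = 0 := hμ ▸ integral_id_multivariateGaussian
  have hvar : ∀ ℓ : StrongDual ℝ (RDP.Vec L), ℓ ≠ 0 → Var[ℓ; μ] ≠ 0 := fun ℓ hℓ ↦
    hμ ▸ RDP.variance_multivariateGaussian_ne_zero hS 0 hℓ
  have hzero : ∀ κ : Kernel (RDP.Vec L) (RDP.Vec L), IsMarkovKernel κ →
      ∃ κG : Kernel (RDP.Vec L) (RDP.Vec L), IsMarkovKernel κG ∧ RDP.IsJointlyGaussian μ κG ∧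
        RDP.reconMean μ κG = 0 ∧ RDP.NoWorse φ μ κG κ := by
    intro κ hκ
    -- With infinite distortion there may be no covariance to match, but the distortion inequality
    -- is then vacuous.
    by_cases hd : RDP.distortion μ κ = ∞
    · obtain ⟨κG, h1, h2, h3, h4, h5⟩ := RDP.exists_jointlyGaussian_independent hμ0 hφ
      exact ⟨κG, h1, h2, h3, h4.trans_le zero_le, le_top.trans_eq hd.symm, h5.trans_le zero_le⟩
    · obtain ⟨κG, h1, h2, h3, -, h5⟩ :=
        RDP.exists_jointlyGaussian_noWorse hμ0 hvar hφ hd (Or.inr rfl)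
      exact ⟨κG, h1, h2, h3, h5⟩
  refine ⟨fun κ hκ hd ↦ ?_, hzero, fun D P ↦ le_antisymm ?_ ?_⟩
  · obtain ⟨κG, h1, h2, h3, h4, h5⟩ :=
      RDP.exists_jointlyGaussian_noWorse hμ0 hvar hφ hd (Or.inl rfl)
    refine ⟨κG, h1, h2, h3, ?_, ?_, h5⟩
    · ext i j
      exact h4.map (.snd ℝ _ _) (EuclideanSpace.proj i) (EuclideanSpace.proj j)
    · ext i j
      exact h4 ((EuclideanSpace.proj i).comp (.fst ℝ _ _))
        ((EuclideanSpace.proj j).comp (.snd ℝ _ _))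
  · exact biInf_mono fun κ hκ ↦ hκ.1
  · refine le_iInf₂ fun κ ⟨hκ, hD, hP⟩ ↦ ?_
    obtain ⟨κG, h1, h2, h3, hI, hD', hP'⟩ := hzero κ hκ
    exact (iInf₂_le κG ⟨⟨h1, hD'.trans hD, hP'.trans hP⟩, h2, h3⟩).trans hI
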